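/- Let $A=(a_{ij})_{i,j\in I}$ be a Cartan matrix of finite type and let $\mathfrak g=\mathfrak g(A)$ be the semisimple complex Lie algebra with Chevalley generators $e_i,f_i,h_i$ ($i\in I$), where $[h_i,e_j]=a_{ij}e_j$, and Serre relations. Let $\mathfrak h=\bigoplus_i\mathbb C h_i$, let $\alpha_i$ be the simple roots, so $\alpha_j(h_i)=a_{ij}$, and let $s_i$ be the simple reflections. For $X\subseteq I$ let $w_X$ be the longest element of $W_X=\langle s_i\mid i\in X\rangle$. A diagram automorphism is a permutation $\tau$ of $I$ with $a_{\tau(i)\tau(j)}=a_{ij}$ for all $i,j$; it acts on $\mathfrak g$ and on roots by relabelling. A generalized Satake diagram is a pair $(X,\tau)$ with $X\subseteq I$ and $\tau$ a diagram automorphism such that $\tau^2=\mathrm{id}$, $\tau(X)=X$, $-w_X(\alpha_i)=\alpha_{\tau(i)}$ for $i\in X$, and such that for no $i\in I\setminus X$ the nodes $i,\tau(i)$ together with the connected components of $X$ neighbouring $i$ or $\tau(i)$ form a diagram of type $\mathrm A_2$ with one node outside $X$ and one node in $X$. Fix a generalized Satake diagram $(X,\tau)$ and a set $I^*\subseteq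 I\setminus X$ containing precisely one element of each $\tau$-orbit in $I\setminus X$. Put $\theta=-w_X\tau$ on $\mathfrak h^*$, and $\theta=\mathrm{Ad}(w_X)\,\tau\,\omega$ on $\mathfrak g$, where $\omega$ is the Chevalley involution ($e_i\mapsto -f_i$, $f_i\mapsto -e_i$, $h_i\mapsto -h_i$) and $\mathrm{Ad}(w_X)=\mathrm{Ad}(s_{i_1})\cdots\mathrm{Ad}(s_{i_\ell})$ for any reduced expression $w_X=s_{i_1}\cdots s_{i_\ell}$, with $\mathrm{Ad}(s_i)=\exp(\mathrm{ad}\,e_i)\exp(\mathrm{ad}(-f_i))\exp(\mathrm{ad}\,e_i)$. Let $\mathfrak h^\theta$ be the fixed points of $\theta$ in $\mathfrak h$, and define $$I_{\rm diff}=\{i\in I^*\mid i\neq\tau(i),\ (\theta(\alpha_i))(h_i)\neq 0\},\qquad I_{\rm ns}=\{i\in I\mid(\theta(\alpha_i))(h_i)=-2\},$$ $$I_{\rm nsf}=\{j\in I_{\rm ns}\mid a_{ij}\in 2\mathbb Z\ \text{for all } i\in I_{\rm ns}\},$$ $$\Gamma=\{\gamma\in(\mathbb C^\times)^{I\setminus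 X}\mid\gamma_i=\gamma_{\tau(i)}\ \text{if } i\in I^*\setminus I_{\rm diff}\},\qquad \widetilde\Gamma=\{\gamma\in\Gamma\mid\gamma_i=1\ \text{if } i\in I^*\setminus I_{\rm diff}\},$$ $$\Sigma=\{\sigma\in\mathbb C^{I\setminus X}\mid\sigma_i=0\ \text{if } i\in I^*\setminus I_{\rm nsf}\}.$$ For $\gamma\in\Gamma$ and $\sigma\in\mathbb C^{I\setminus X}$ let $U(\mathfrak k_\gamma)_\sigma\subseteq U(\mathfrak g)$ be the unital subalgebra generated by $e_i,f_i$ ($i\in X$), $\mathfrak h^\theta$, and $f_i+\gamma_i\theta(f_i)+\sigma_i$ ($i\in I\setminus X$). Call two subalgebras $B,B'$ of $U(\mathfrak g)$ equivalent if $B'=\phi(B)$ for some Hopf algebra automorphism $\phi$ of $U(\mathfrak g)$. Proposition. For every $\gamma\in\Gamma$ and every $\sigma\in\mathbb C^{I\setminus X}$ there exist $\tilde\gamma\in\widetilde\Gamma$ and $\sigma'\in\Sigma$ such that $U(\mathfrak k_\gamma)_\sigma$ is equivalent to $U(\mathfrak k_{\tilde\gamma})_{\sigma'}$. -/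

import Mathlib

open scoped TensorProduct

/-! ### The Hopf algebra structure of a universal enveloping algebra -/

namespace EnvHopf

variable (L : Type*) [LieRing L] [LieAlgebra ℂ L]

attribute [local instance 100] LieRing.ofAssociativeRing

/-- The map `x ↦ x ⊗ 1 + 1 ⊗ x` from a Lie algebra to `U(L) ⊗ U(L)`. -/
noncomputable def comulLie :
    L →ₗ⁅ℂ⁆ UniversalEnvelopingAlgebra ℂ L ⊗[ℂ] UniversalEnvelopingAlgebra ℂ L :=
  { ((TensorProduct.mk ℂ _ _).flip 1 ∘ₗ (UniversalEnvelopingAlgebra.ι ℂ : L →ₗ⁅ℂ⁆ _).toLinearMap) +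
      (TensorProduct.mk ℂ _ _ 1 ∘ₗ (UniversalEnvelopingAlgebra.ι ℂ : L →ₗ⁅ℂ⁆ _).toLinearMap) with
    map_lie' := by
      intro x y
      simp only [LinearMap.add_apply, LinearMap.comp_apply, LinearMap.flip_apply,
        TensorProduct.mk_apply, LieHom.coe_toLinearMap, AddHom.toFun_eq_coe,
        LinearMap.coe_toAddHom, LieHom.map_lie, LieRing.of_associative_ring_bracket]
      simp only [add_mul, mul_add, Algebra.TensorProduct.tmul_mul_tmul, one_mul, mul_one,
        TensorProduct.sub_tmul, TensorProduct.tmul_sub]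
      abel }

/-- The comultiplication of `U(L)`: elements of `L` are primitive. -/
noncomputable def comulHom : UniversalEnvelopingAlgebra ℂ L →ₐ[ℂ]
    UniversalEnvelopingAlgebra ℂ L ⊗[ℂ] UniversalEnvelopingAlgebra ℂ L :=
  UniversalEnvelopingAlgebra.lift ℂ (comulLie L)

/-- The counit of `U(L)`: it vanishes on `L`. -/
noncomputable def counitHom : UniversalEnvelopingAlgebra ℂ L →ₐ[ℂ] ℂ :=
  UniversalEnvelopingAlgebra.lift ℂ (0 : L →ₗ⁅ℂ⁆ ℂ)

/-- The map `x ↦ -x` from `L` to the opposite of `U(L)`. -/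
noncomputable def antipodeLie : L →ₗ⁅ℂ⁆ (UniversalEnvelopingAlgebra ℂ L)ᵐᵒᵖ :=
  { -((MulOpposite.opLinearEquiv ℂ).toLinearMap ∘ₗ
      (UniversalEnvelopingAlgebra.ι ℂ : L →ₗ⁅ℂ⁆ _).toLinearMap) with
    map_lie' := by
      intro x y
      simp only [LinearMap.neg_apply, LinearMap.comp_apply, LieHom.coe_toLinearMap,
        AddHom.toFun_eq_coe, LinearMap.coe_toAddHom, LieHom.map_lie,
        LieRing.of_associative_ring_bracket, LinearEquiv.coe_coe,
        MulOpposite.coe_opLinearEquiv, neg_mul_neg, ← MulOpposite.op_mul, ← MulOpposite.op_sub,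
        ← MulOpposite.op_neg, neg_sub] }

/-- The antipode of `U(L)`, as an algebra homomorphism to the opposite algebra. -/
noncomputable def antipodeHom :
    UniversalEnvelopingAlgebra ℂ L →ₐ[ℂ] (UniversalEnvelopingAlgebra ℂ L)ᵐᵒᵖ :=
  UniversalEnvelopingAlgebra.lift ℂ (antipodeLie L)

/-- The antipode of `U(L)`: the anti-automorphism that is `-1` on `L`. -/
noncomputable def antipodeMap :
    UniversalEnvelopingAlgebra ℂ L →ₗ[ℂ] UniversalEnvelopingAlgebra ℂ L :=
  (MulOpposite.opLinearEquiv ℂ).symm.toLinearMap ∘ₗ (antipodeHom L).toLinearMap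

theorem comulHom_ι (x : L) :
    comulHom L (UniversalEnvelopingAlgebra.ι ℂ x) =
      UniversalEnvelopingAlgebra.ι ℂ x ⊗ₜ[ℂ] (1 : UniversalEnvelopingAlgebra ℂ L) +
        (1 : UniversalEnvelopingAlgebra ℂ L) ⊗ₜ[ℂ] UniversalEnvelopingAlgebra.ι ℂ x :=
  UniversalEnvelopingAlgebra.lift_ι_apply ℂ _ x

theorem counitHom_ι (x : L) : counitHom L (UniversalEnvelopingAlgebra.ι ℂ x) = 0 :=
  UniversalEnvelopingAlgebra.lift_ι_apply ℂ _ x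

theorem antipodeMap_ι (x : L) :
    antipodeMap L (UniversalEnvelopingAlgebra.ι ℂ x) = -UniversalEnvelopingAlgebra.ι ℂ x := by
  have h : antipodeHom L (UniversalEnvelopingAlgebra.ι ℂ x) = antipodeLie L x :=
    UniversalEnvelopingAlgebra.lift_ι_apply ℂ _ x
  simp only [antipodeMap, LinearMap.comp_apply, AlgHom.toLinearMap_apply, h]
  rfl

theorem antipodeMap_mul (a b : UniversalEnvelopingAlgebra ℂ L) :
    antipodeMap L (a * b) = antipodeMap L b * antipodeMap L a := by
  simp [antipodeMap]

theorem antipodeMap_one : antipodeMap L 1 = 1 := by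
  simp [antipodeMap]

theorem env_induction {P : UniversalEnvelopingAlgebra ℂ L → Prop}
    (hι : ∀ x, P (UniversalEnvelopingAlgebra.ι ℂ x)) (hs : ∀ c : ℂ, P (algebraMap ℂ _ c))
    (hm : ∀ a b, P a → P b → P (a * b)) (ha : ∀ a b, P a → P b → P (a + b))
    (a : UniversalEnvelopingAlgebra ℂ L) : P a := by
  let S : Subalgebra ℂ (UniversalEnvelopingAlgebra ℂ L) :=
    { carrier := {a | P a}
      mul_mem' := fun h₁ h₂ => hm _ _ h₁ h₂
      add_mem' := fun h₁ h₂ => ha _ _ h₁ h₂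
      algebraMap_mem' := hs }
  let g : L →ₗ⁅ℂ⁆ S :=
    { toFun := fun x => ⟨UniversalEnvelopingAlgebra.ι ℂ x, hι x⟩
      map_add' := fun x y => Subtype.ext (by simp)
      map_smul' := fun c x => Subtype.ext (by simp)
      map_lie' := fun {x y} => Subtype.ext (by
        simp only [LieHom.map_lie, LieRing.of_associative_ring_bracket]; rfl) }
  have h : S.val.comp (UniversalEnvelopingAlgebra.lift ℂ g) = AlgHom.id ℂ _ := by
    apply UniversalEnvelopingAlgebra.hom_ext
    apply LieHom.ext
    intro x
    change S.val (UniversalEnvelopingAlgebra.lift ℂ g (UniversalEnvelopingAlgebra.ι ℂ x)) =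
      UniversalEnvelopingAlgebra.ι ℂ x
    rw [UniversalEnvelopingAlgebra.lift_ι_apply]
    rfl
  have h' := DFunLike.congr_fun h a
  have h2 := (UniversalEnvelopingAlgebra.lift ℂ g a).2
  change ((UniversalEnvelopingAlgebra.lift ℂ g a : S) : UniversalEnvelopingAlgebra ℂ L) = a at h'
  rw [h'] at h2
  exact h2

noncomputable instance instBialgebra : Bialgebra ℂ (UniversalEnvelopingAlgebra ℂ L) :=
  Bialgebra.ofAlgHom (comulHom L) (counitHom L)
    (by
      apply UniversalEnvelopingAlgebra.hom_ext
      apply LieHom.ext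
      intro x
      simp [comulHom_ι, TensorProduct.add_tmul, TensorProduct.tmul_add,
        Algebra.TensorProduct.one_def, -UniversalEnvelopingAlgebra.ι_apply, add_assoc])
    (by
      refine AlgHom.ext fun a => ?_
      induction a using env_induction with
      | hι x => simp [comulHom_ι, counitHom_ι, -UniversalEnvelopingAlgebra.ι_apply]
      | hs c => rw [AlgHom.commutes]; exact (AlgHom.commutes _ c).symm
      | hm a b h₁ h₂ => rw [map_mul, h₁, h₂]; exact (map_mul _ a b).symm
      | ha a b h₁ h₂ => rw [map_add, h₁, h₂]; exact (map_add _ a b).symm)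
    (by
      apply UniversalEnvelopingAlgebra.hom_ext
      apply LieHom.ext
      intro x
      simp [comulHom_ι, counitHom_ι, -UniversalEnvelopingAlgebra.ι_apply])

theorem comul_eq (a : UniversalEnvelopingAlgebra ℂ L) :
    Coalgebra.comul (R := ℂ) a = comulHom L a := rfl

theorem counit_eq (a : UniversalEnvelopingAlgebra ℂ L) :
    Coalgebra.counit (R := ℂ) a = counitHom L a := rfl

/-- The Hopf algebra structure of `U(L)`: elements of `L` are primitive. -/
noncomputable instance instHopfAlgebra : HopfAlgebra ℂ (UniversalEnvelopingAlgebra ℂ L) :=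
  { instBialgebra L with
    antipode := antipodeMap L
    mul_antipode_rTensor_comul := by
      have key : ∀ s t : UniversalEnvelopingAlgebra ℂ L ⊗[ℂ] UniversalEnvelopingAlgebra ℂ L,
          ∀ c : ℂ, LinearMap.mul' ℂ _ ((antipodeMap L).rTensor _ s) = algebraMap ℂ _ c →
          LinearMap.mul' ℂ _ ((antipodeMap L).rTensor _ (s * t)) =
            c • LinearMap.mul' ℂ _ ((antipodeMap L).rTensor _ t) := by
        intro s t c hs
        induction t with
        | zero => simp
        | add t₁ t₂ h₁ h₂ => simp only [mul_add, map_add, h₁, h₂, smul_add]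
        | tmul u v =>
          have : LinearMap.mul' ℂ _ ((antipodeMap L).rTensor _ (s * u ⊗ₜ[ℂ] v)) =
              antipodeMap L u * LinearMap.mul' ℂ _ ((antipodeMap L).rTensor _ s) * v := by
            clear hs
            induction s with
            | zero => simp
            | add t₁ t₂ h₁ h₂ => simp only [mul_add, add_mul, map_add, h₁, h₂]
            | tmul a b => simp [antipodeMap_mul, mul_assoc]
          rw [this, hs]
          simp [Algebra.algebraMap_eq_smul_one]
      ext a
      change LinearMap.mul' ℂ _ ((antipodeMap L).rTensor _ (comulHom L a)) =
        algebraMap ℂ _ (counitHom L a)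
      induction a using env_induction with
      | hι x => simp [comulHom_ι, counitHom_ι, antipodeMap_ι, antipodeMap_one,
          -UniversalEnvelopingAlgebra.ι_apply]
      | hs c => simp [Algebra.algebraMap_eq_smul_one,
          antipodeMap_one, Algebra.TensorProduct.one_def]
      | hm a b h₁ h₂ => rw [map_mul, key _ _ _ h₁, h₂, map_mul, map_mul, Algebra.smul_def]
      | ha a b h₁ h₂ => simp only [map_add, h₁, h₂]
    mul_antipode_lTensor_comul := by
      have key : ∀ s t : UniversalEnvelopingAlgebra ℂ L ⊗[ℂ] UniversalEnvelopingAlgebra ℂ L,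
          ∀ c : ℂ, LinearMap.mul' ℂ _ ((antipodeMap L).lTensor _ t) = algebraMap ℂ _ c →
          LinearMap.mul' ℂ _ ((antipodeMap L).lTensor _ (s * t)) =
            c • LinearMap.mul' ℂ _ ((antipodeMap L).lTensor _ s) := by
        intro s t c ht
        induction s with
        | zero => simp
        | add t₁ t₂ h₁ h₂ => simp only [add_mul, map_add, h₁, h₂, smul_add]
        | tmul u v =>
          have : LinearMap.mul' ℂ _ ((antipodeMap L).lTensor _ (u ⊗ₜ[ℂ] v * t)) =
              u * LinearMap.mul' ℂ _ ((antipodeMap L).lTensor _ t) * antipodeMap L v := by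
            clear ht
            induction t with
            | zero => simp
            | add t₁ t₂ h₁ h₂ => simp only [mul_add, add_mul, map_add, h₁, h₂]
            | tmul a b => simp [antipodeMap_mul, mul_assoc]
          rw [this, ht]
          simp [Algebra.algebraMap_eq_smul_one]
      ext a
      change LinearMap.mul' ℂ _ ((antipodeMap L).lTensor _ (comulHom L a)) =
        algebraMap ℂ _ (counitHom L a)
      induction a using env_induction with
      | hι x => simp [comulHom_ι, counitHom_ι, antipodeMap_ι, antipodeMap_one,
          -UniversalEnvelopingAlgebra.ι_apply]
      | hs c => simp [Algebra.algebraMap_eq_smul_one,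
          antipodeMap_one, Algebra.TensorProduct.one_def]
      | hm a b h₁ h₂ => rw [map_mul, key _ _ _ h₂, h₁, map_mul, mul_comm (counitHom L a),
          map_mul, Algebra.smul_def]
      | ha a b h₁ h₂ => simp only [map_add, h₁, h₂] }

end EnvHopf

/-! ### The semisimple Lie algebra of a Cartan matrix -/

namespace SatakePair

/-- `A` is a Cartan matrix (of finite type): a generalized Cartan matrix that becomes symmetric
and positive definite after its rows are scaled by suitable positive rationals `d i`. -/
structure IsCartanMatrix {I : Type*} [Fintype I] [DecidableEq I] (A : Matrix I I ℤ) : Prop where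
  diag : ∀ i, A i i = 2
  nonpos : ∀ i j, i ≠ j → A i j ≤ 0
  zero_symm : ∀ i j, A i j = 0 → A j i = 0
  posDef : ∃ d : I → ℚ, (∀ i, 0 < d i) ∧ (∀ i j, d i * A i j = d j * A j i) ∧
    (Matrix.of fun i j => (d i : ℝ) * (A i j : ℝ)).PosDef

section LieAlg

variable {I : Type*} [DecidableEq I] (A : Matrix I I ℤ)

/-- The Lie algebra `𝔤(A)` over `ℂ`, given by the Chevalley generators and the Serre relations. -/
abbrev 𝔤 : Type _ := Matrix.ToLieAlgebra ℂ A

/-- The projection from the free Lie algebra on the Chevalley generators to `𝔤(A)`. -/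
noncomputable def proj : FreeLieAlgebra ℂ (CartanMatrix.Generators I) →ₗ⁅ℂ⁆ 𝔤 A :=
  { (LieSubmodule.Quotient.mk' (CartanMatrix.Relations.toIdeal ℂ A)).toLinearMap with
    map_lie' := fun {x y} => LieSubmodule.Quotient.mk_bracket _ x y }

/-- The Chevalley generator `h_i`. -/
noncomputable def h (i : I) : 𝔤 A := proj A (FreeLieAlgebra.of ℂ (.H i))

/-- The Chevalley generator `e_i`. -/
noncomputable def e (i : I) : 𝔤 A := proj A (FreeLieAlgebra.of ℂ (.E i))

/-- The Chevalley generator `f_i`. -/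
noncomputable def f (i : I) : 𝔤 A := proj A (FreeLieAlgebra.of ℂ (.F i))

theorem proj_eq_zero {x : FreeLieAlgebra ℂ (CartanMatrix.Generators I)}
    (hx : x ∈ CartanMatrix.Relations.toSet ℂ A) : proj A x = 0 :=
  (LieSubmodule.Quotient.mk_eq_zero (N := CartanMatrix.Relations.toIdeal ℂ A)).2
    (LieSubmodule.subset_lieSpan hx)

theorem lieHom_ad_pow {L L' : Type*} [LieRing L] [LieAlgebra ℂ L] [LieRing L'] [LieAlgebra ℂ L']
    (φ : L →ₗ⁅ℂ⁆ L') (x y : L) (n : ℕ) :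
    φ ((LieAlgebra.ad ℂ L x ^ n) y) = (LieAlgebra.ad ℂ L' (φ x) ^ n) (φ y) := by
  induction n with
  | zero => simp
  | succ n ih => simp only [pow_succ', Module.End.mul_apply, LieAlgebra.ad_apply,
      LieHom.map_lie, ih]

/-- The defining relations of `𝔤(A)`, for elements of an arbitrary Lie algebra. -/
structure SerreRelations {L : Type*} [LieRing L] [LieAlgebra ℂ L] (e' f' h' : I → L) : Prop where
  hh : ∀ i j, ⁅h' i, h' j⁆ = 0
  he : ∀ i j, ⁅h' i, e' j⁆ = A i j • e' j
  hf : ∀ i j, ⁅h' i, f' j⁆ = -(A i j • f' j)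
  ef_same : ∀ i, ⁅e' i, f' i⁆ = h' i
  ef_ne : ∀ i j, i ≠ j → ⁅e' i, f' j⁆ = 0
  ee : ∀ i j, (LieAlgebra.ad ℂ L (e' i) ^ (-A i j).toNat) ⁅e' i, e' j⁆ = 0
  ff : ∀ i j, (LieAlgebra.ad ℂ L (f' i) ^ (-A i j).toNat) ⁅f' i, f' j⁆ = 0

theorem serreRelations : SerreRelations A (e A) (f A) (h A) where
  hh i j := by
    have := proj_eq_zero A (x := CartanMatrix.Relations.HH ℂ (i, j))
      (by simp [CartanMatrix.Relations.toSet])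
    simpa [CartanMatrix.Relations.HH, LieHom.map_lie, h, e, f] using this
  he i j := by
    have := proj_eq_zero A (x := CartanMatrix.Relations.HE ℂ A (i, j))
      (by simp [CartanMatrix.Relations.toSet])
    simpa [CartanMatrix.Relations.HE, LieHom.map_lie, sub_eq_zero, h, e, f] using this
  hf i j := by
    have := proj_eq_zero A (x := CartanMatrix.Relations.HF ℂ A (i, j))
      (by simp [CartanMatrix.Relations.toSet])
    simpa [CartanMatrix.Relations.HF, LieHom.map_lie, add_eq_zero_iff_eq_neg, h, e, f] using this
  ef_same i := by
    have := proj_eq_zero A (x := CartanMatrix.Relations.EF ℂ (i, i))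
      (by simp [CartanMatrix.Relations.toSet])
    simpa [CartanMatrix.Relations.EF, LieHom.map_lie, sub_eq_zero, h, e, f] using this
  ef_ne i j hij := by
    have := proj_eq_zero A (x := CartanMatrix.Relations.EF ℂ (i, j))
      (by simp [CartanMatrix.Relations.toSet])
    simpa [CartanMatrix.Relations.EF, LieHom.map_lie, hij, h, e, f] using this
  ee i j := by
    have := proj_eq_zero A (x := CartanMatrix.Relations.adE ℂ A (i, j))
      (by simp [CartanMatrix.Relations.toSet])
    simpa [CartanMatrix.Relations.adE, LieHom.map_lie, lieHom_ad_pow, h, e, f] using this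
  ff i j := by
    have := proj_eq_zero A (x := CartanMatrix.Relations.adF ℂ A (i, j))
      (by simp [CartanMatrix.Relations.toSet])
    simpa [CartanMatrix.Relations.adF, LieHom.map_lie, lieHom_ad_pow, h, e, f] using this

variable {A} in
/-- The universal property of `𝔤(A)`. -/
noncomputable def liftHom {L : Type*} [LieRing L] [LieAlgebra ℂ L] {e' f' h' : I → L}
    (H : SerreRelations A e' f' h') : 𝔤 A →ₗ⁅ℂ⁆ L :=
  let φ : FreeLieAlgebra ℂ (CartanMatrix.Generators I) →ₗ⁅ℂ⁆ L :=
    FreeLieAlgebra.lift ℂ fun g => match g with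
      | .H i => h' i
      | .E i => e' i
      | .F i => f' i
  have hφ : CartanMatrix.Relations.toIdeal ℂ A ≤ φ.ker := by
    refine LieSubmodule.lieSpan_le.2 ?_
    intro x hx
    simp only [CartanMatrix.Relations.toSet, Set.mem_union, Set.mem_range, Prod.exists] at hx
    change x ∈ φ.ker
    rw [LieHom.mem_ker]
    rcases hx with (((((⟨i, j, rfl⟩ | ⟨i, j, rfl⟩) | ⟨i, j, rfl⟩) | ⟨i, j, rfl⟩) | ⟨i, j, rfl⟩) |
      ⟨i, j, rfl⟩)
    · simp [CartanMatrix.Relations.HH, φ, H.hh]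
    · by_cases hij : i = j
      · subst hij
        simp [CartanMatrix.Relations.EF, φ, H.ef_same]
      · simp [CartanMatrix.Relations.EF, φ, hij, H.ef_ne i j hij]
    · simp [CartanMatrix.Relations.HE, φ, H.he]
    · simp [CartanMatrix.Relations.HF, φ, H.hf]
    · simp [CartanMatrix.Relations.adE, φ, lieHom_ad_pow, H.ee]
    · simp [CartanMatrix.Relations.adF, φ, lieHom_ad_pow, H.ff]
  { Submodule.liftQ (CartanMatrix.Relations.toIdeal ℂ A).toSubmodule φ.toLinearMap
      (fun x hx => hφ hx) with
    map_lie' := by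
      intro x y
      obtain ⟨x, rfl⟩ := Submodule.Quotient.mk_surjective _ x
      obtain ⟨y, rfl⟩ := Submodule.Quotient.mk_surjective _ y
      exact φ.map_lie x y }

theorem liftHom_proj {L : Type*} [LieRing L] [LieAlgebra ℂ L] {e' f' h' : I → L}
    (H : SerreRelations A e' f' h') (g : CartanMatrix.Generators I) :
    liftHom H (proj A (FreeLieAlgebra.of ℂ g)) = match g with
      | .H i => h' i
      | .E i => e' i
      | .F i => f' i :=
  FreeLieAlgebra.lift_of_apply _ g

theorem liftHom_h {L : Type*} [LieRing L] [LieAlgebra ℂ L] {e' f' h' : I → L}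
    (H : SerreRelations A e' f' h') (i : I) : liftHom H (h A i) = h' i := liftHom_proj A H (.H i)

theorem liftHom_e {L : Type*} [LieRing L] [LieAlgebra ℂ L] {e' f' h' : I → L}
    (H : SerreRelations A e' f' h') (i : I) : liftHom H (e A i) = e' i := liftHom_proj A H (.E i)

theorem liftHom_f {L : Type*} [LieRing L] [LieAlgebra ℂ L] {e' f' h' : I → L}
    (H : SerreRelations A e' f' h') (i : I) : liftHom H (f A i) = f' i := liftHom_proj A H (.F i)

theorem ad_neg_pow {L : Type*} [LieRing L] [LieAlgebra ℂ L] {x y : L} {n : ℕ}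
    (hxy : (LieAlgebra.ad ℂ L x ^ n) ⁅x, y⁆ = 0) :
    (LieAlgebra.ad ℂ L (-x) ^ n) ⁅-x, -y⁆ = 0 := by
  rw [map_neg, neg_pow, neg_lie, lie_neg, neg_neg, Module.End.mul_apply, hxy, map_zero]

/-- The Chevalley involution: `e_i ↦ -f_i`, `f_i ↦ -e_i`, `h_i ↦ -h_i`. -/
noncomputable def chevalley : 𝔤 A →ₗ⁅ℂ⁆ 𝔤 A :=
  liftHom (A := A) (e' := fun i => -f A i) (f' := fun i => -e A i) (h' := fun i => -h A i)
    { hh := fun i j => by simp [(serreRelations A).hh]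
      he := fun i j => by simp [(serreRelations A).hf]
      hf := fun i j => by simp [(serreRelations A).he]
      ef_same := fun i => by
        rw [neg_lie, lie_neg, neg_neg, ← lie_skew, (serreRelations A).ef_same]
      ef_ne := fun i j hij => by
        rw [neg_lie, lie_neg, neg_neg, ← lie_skew, (serreRelations A).ef_ne j i hij.symm, neg_zero]
      ee := fun i j => ad_neg_pow ((serreRelations A).ff i j)
      ff := fun i j => ad_neg_pow ((serreRelations A).ee i j) }

/-- The group `Aut(A)` of diagram automorphisms. -/
def diagramAut : Subgroup (Equiv.Perm I) where
  carrier := {τ | ∀ i j, A (τ i) (τ j) = A i j}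
  mul_mem' := fun {a b} ha hb i j => (ha (b i) (b j)).trans (hb i j)
  one_mem' := fun _ _ => rfl
  inv_mem' := fun {a} ha i j => by
    have := ha (a⁻¹ i) (a⁻¹ j)
    simpa using this.symm

variable {A} in
/-- The action of a diagram automorphism on `𝔤(A)` by relabelling of the generators. -/
noncomputable def relabel (τ : diagramAut A) : 𝔤 A →ₗ⁅ℂ⁆ 𝔤 A :=
  liftHom (A := A) (e' := fun i => e A (τ.1 i)) (f' := fun i => f A (τ.1 i))
    (h' := fun i => h A (τ.1 i))
    { hh := fun i j => (serreRelations A).hh _ _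
      he := fun i j => by rw [(serreRelations A).he, τ.2 i j]
      hf := fun i j => by rw [(serreRelations A).hf, τ.2 i j]
      ef_same := fun i => (serreRelations A).ef_same _
      ef_ne := fun i j hij => (serreRelations A).ef_ne _ _ (fun hc => hij (τ.1.injective hc))
      ee := fun i j => by simpa only [τ.2 i j] using (serreRelations A).ee (τ.1 i) (τ.1 j)
      ff := fun i j => by simpa only [τ.2 i j] using (serreRelations A).ff (τ.1 i) (τ.1 j) }

/-- The exponential of a nilpotent endomorphism `D`. (In `𝔤(A)`, which has finite dimension when
`A` is a Cartan matrix, the endomorphisms `ad e_i` and `ad f_i` are nilpotent.) -/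
noncomputable def nilpExp (D : Module.End ℂ (𝔤 A)) : Module.End ℂ (𝔤 A) :=
  ∑ n ∈ Finset.range (nilpotencyClass D), ((n.factorial : ℂ)⁻¹) • D ^ n

/-- `Ad(s_i) = exp(ad e_i) exp(ad (-f_i)) exp(ad e_i)`. -/
noncomputable def adSimple (i : I) : Module.End ℂ (𝔤 A) :=
  nilpExp A (LieAlgebra.ad ℂ (𝔤 A) (e A i)) * nilpExp A (LieAlgebra.ad ℂ (𝔤 A) (-f A i)) *
    nilpExp A (LieAlgebra.ad ℂ (𝔤 A) (e A i))

/-- `Ad(s_{i₁}) ⋯ Ad(s_{iₗ})` for a word `i₁ ⋯ iₗ`; this is `Ad(w)` when the word is a reduced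
expression of `w`. -/
noncomputable def adWord (w : List I) : Module.End ℂ (𝔤 A) := (w.map (adSimple A)).prod

/-- The Cartan subalgebra `𝔥`, the span of the `h_i`. -/
noncomputable def cartan : Submodule ℂ (𝔤 A) := Submodule.span ℂ (Set.range (h A))

end LieAlg

/-! ### Root lattice and Weyl group -/

section Weyl

variable {I : Type*} [Fintype I] [DecidableEq I] (A : Matrix I I ℤ)

/-- The simple root `α_i` in the root lattice `Q = ⨁ ℤ α_i`, whose elements are written as their
families of coefficients. -/
def simpleRoot (i : I) : I → ℤ := Pi.single i 1

/-- The pairing `β(h_i)`, determined by `α_j(h_i) = a_{ij}`. -/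
def pairing (i : I) : (I → ℤ) →ₗ[ℤ] ℤ := ∑ j, A i j • LinearMap.proj j

/-- The simple reflection `s_i(β) = β - β(h_i) α_i`. -/
def reflection (i : I) : Module.End ℤ (I → ℤ) :=
  LinearMap.id - (pairing A i).smulRight (simpleRoot i)

/-- The element `s_{i₁} ⋯ s_{iₗ}` of the Weyl group, for a word `i₁ ⋯ iₗ`. -/
def weylWord (w : List I) : Module.End ℤ (I → ℤ) := (w.map (reflection A)).prod

/-- A word is reduced if no shorter word gives the same element of the Weyl group. -/
def IsReduced (w : List I) : Prop :=
  ∀ w' : List I, weylWord A w' = weylWord A w → w.length ≤ w'.length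

/-- `w` is a reduced expression of the longest element `w_X` of the parabolic subgroup
`W_X = ⟨s_i | i ∈ X⟩`. -/
structure IsLongestWord (X : Set I) (w : List I) : Prop where
  mem : ∀ i ∈ w, i ∈ X
  reduced : IsReduced A w
  longest : ∀ w' : List I, (∀ i ∈ w', i ∈ X) → IsReduced A w' → w'.length ≤ w.length

/-! ### Generalized Satake diagrams -/

variable {A}

/-- Compatible decorations `(X, τ)`: `τ` is an involutive diagram automorphism (possibly trivial)
with `τ(X) = X`, and on `X` it is given by `-w_X(α_i) = α_{τ(i)}`. -/
structure IsCompatibleDecoration (X : Set I) (τ : diagramAut A) : Prop where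
  sq : ∀ i, τ.1 (τ.1 i) = i
  image : τ.1 '' X = X
  restrict : ∀ w, IsLongestWord A X w → ∀ i ∈ X, -weylWord A w (simpleRoot i) = simpleRoot (τ.1 i)

variable (A) in
/-- For `i' = τ(i)`: the union of the connected components of the subdiagram `X` that neighbour
`i` or `i'`. -/
def neighbourComponents (X : Set I) (i i' : I) : Set I :=
  {j | ∃ k ∈ X, (A i k ≠ 0 ∨ A i' k ≠ 0) ∧
    Relation.ReflTransGen (fun a b => a ∈ X ∧ b ∈ X ∧ A a b ≠ 0) k j}

/-- Generalized Satake diagrams: compatible decorations such that for no `i ∉ X` the decorated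
diagram formed by `i`, `τ(i)` and the components of `X` neighbouring them is of type `A₂` with one
node outside `X` and one node in `X`. -/
structure IsGSat (X : Set I) (τ : diagramAut A) : Prop extends IsCompatibleDecoration X τ where
  no_A₂ : ∀ i ∉ X, ¬ ∃ j ∈ X, τ.1 i = i ∧ neighbourComponents A X i (τ.1 i) = {j} ∧
    A i j = -1 ∧ A j i = -1

/-- `Istar` consists of precisely one element of each `τ`-orbit in `I \ X`. -/
structure IsOrbitSection (X : Set I) (τ : diagramAut A) (Istar : Set I) : Prop where
  subset : ∀ i ∈ Istar, i ∉ X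
  exists_unique : ∀ i ∉ X, ∃! j, j ∈ Istar ∧ (j = i ∨ j = τ.1 i)

/-! In the following definitions `w` stands for a reduced expression of `w_X`. -/

/-- The involution `θ = -w_X τ` of the root lattice, where `τ(α_i) = α_{τ(i)}`. -/
def thetaRoot (τ : diagramAut A) (w : List I) (β : I → ℤ) : I → ℤ :=
  -weylWord A w (fun i => β (τ.1.symm i))

/-- The automorphism `θ = Ad(w_X) τ ω` of `𝔤(A)`. -/
noncomputable def theta (τ : diagramAut A) (w : List I) : Module.End ℂ (𝔤 A) :=
  adWord A w * (relabel τ).toLinearMap * (chevalley A).toLinearMap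

/-- `𝔥^θ`, the fixed points of `θ` in `𝔥`. -/
noncomputable def cartanFixed (τ : diagramAut A) (w : List I) : Submodule ℂ (𝔤 A) :=
  cartan A ⊓ LinearMap.ker (theta τ w - 1)

/-- `I_diff = {i ∈ I* | i ≠ τ(i), (θ(α_i))(h_i) ≠ 0}`. -/
def Idiff (τ : diagramAut A) (w : List I) (Istar : Set I) : Set I :=
  {i | i ∈ Istar ∧ i ≠ τ.1 i ∧ pairing A i (thetaRoot τ w (simpleRoot i)) ≠ 0}

/-- `I_ns = {i ∈ I | (θ(α_i))(h_i) = -2}`. -/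
def Ins (τ : diagramAut A) (w : List I) : Set I :=
  {i | pairing A i (thetaRoot τ w (simpleRoot i)) = -2}

/-- `I_nsf = {j ∈ I_ns | a_{ij} is even for all i ∈ I_ns}`. -/
def Insf (τ : diagramAut A) (w : List I) : Set I :=
  {j | j ∈ Ins τ w ∧ ∀ i ∈ Ins τ w, Even (A i j)}

/-- The set `Γ` of the families `γ` of nonzero complex numbers indexed by `I \ X` with
`γ_i = γ_{τ(i)}` for `i ∈ I* \ I_diff`. -/
def Gam (X : Set I) (τ : diagramAut A) (w : List I) (Istar : Set I) : Set ({i // i ∉ X} → ℂ) :=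
  {γ | (∀ i, γ i ≠ 0) ∧
    ∀ i j : {i // i ∉ X}, i.1 ∈ Istar → i.1 ∉ Idiff τ w Istar → j.1 = τ.1 i.1 → γ i = γ j}

/-- The set `Γ̃` of the `γ ∈ Γ` with `γ_i = 1` for `i ∈ I* \ I_diff`. -/
def GamTilde (X : Set I) (τ : diagramAut A) (w : List I) (Istar : Set I) :
    Set ({i // i ∉ X} → ℂ) :=
  {γ | γ ∈ Gam X τ w Istar ∧
    ∀ i : {i // i ∉ X}, i.1 ∈ Istar → i.1 ∉ Idiff τ w Istar → γ i = 1}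

/-- The set `Σ` of the `σ` indexed by `I \ X` with `σ_i = 0` for `i ∈ I* \ I_nsf`. -/
def Sig (X : Set I) (τ : diagramAut A) (w : List I) (Istar : Set I) : Set ({i // i ∉ X} → ℂ) :=
  {σ | ∀ i : {i // i ∉ X}, i.1 ∈ Istar → i.1 ∉ Insf τ w → σ i = 0}

/-! ### The subalgebras `U(𝔨_γ)_σ` -/

variable (A) in
/-- The universal enveloping algebra `U(𝔤)`. -/
abbrev U𝔤 : Type _ := UniversalEnvelopingAlgebra ℂ (𝔤 A)

/-- The element `b_{i;γ_i} = f_i + γ_i θ(f_i)` of `𝔤`. -/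
noncomputable def b (τ : diagramAut A) (w : List I) (i : I) (c : ℂ) : 𝔤 A :=
  f A i + c • theta τ w (f A i)

/-- `U(𝔨_γ)_σ`: the unital subalgebra of `U(𝔤)` generated by `e_i`, `f_i` for `i ∈ X`, by `𝔥^θ`
and by `b_{i;γ_i,σ_i} = f_i + γ_i θ(f_i) + σ_i` for `i ∈ I \ X`. -/
noncomputable def Uk (X : Set I) (τ : diagramAut A) (w : List I) (γ σ : {i // i ∉ X} → ℂ) :
    Subalgebra ℂ (U𝔤 A) :=
  Algebra.adjoin ℂ
    ((fun i => UniversalEnvelopingAlgebra.ι ℂ (e A i)) '' X ∪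
      (fun i => UniversalEnvelopingAlgebra.ι ℂ (f A i)) '' X ∪
      (fun x => UniversalEnvelopingAlgebra.ι ℂ x) '' (cartanFixed τ w : Set (𝔤 A)) ∪
      Set.range fun i : {i // i ∉ X} =>
        UniversalEnvelopingAlgebra.ι ℂ (b τ w i.1 (γ i)) + algebraMap ℂ (U𝔤 A) (σ i))

/-- Two subalgebras of `U(𝔤)` are equivalent if a Hopf algebra automorphism of `U(𝔤)` maps one onto
the other. (A bialgebra automorphism of a Hopf algebra commutes with the antipode.) -/
def HopfEquivalent (B B' : Subalgebra ℂ (U𝔤 A)) : Prop :=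
  ∃ φ : U𝔤 A ≃ₐc[ℂ] U𝔤 A, B' = B.map (φ : U𝔤 A →ₐ[ℂ] U𝔤 A)

end Weyl

end SatakePair

/-! Two observations carry the proof. First, since $U(\mathfrak k_\gamma)_\sigma$ contains the
scalars, the generator $f_i+\gamma_i\theta(f_i)+\sigma_i$ may be replaced by
$f_i+\gamma_i\theta(f_i)$, so the subalgebra does not depend on $\sigma$ (`ι_mem_Uk_b`). Only
$\gamma$ has to be normalized, and any element of $\Sigma$ can serve as $\sigma'$.

Second, $\gamma$ is normalized by the torus. A character $\chi$ with $\chi_i=1$ on $X$ fixes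
$e_i,f_i$ for $i\in X$, hence commutes with $\mathrm{Ad}(w_X)$. As
$\theta(f_i)=-\mathrm{Ad}(w_X)(e_{\tau(i)})$, this vector is scaled by $\chi_{\tau(i)}$ while $f_i$
is scaled by $\chi_i^{-1}$; up to the factor $\chi_i^{-1}$ the effect is to replace $\gamma_i$ by
$\gamma_i\chi_i\chi_{\tau(i)}$ (`torus_b`, `hopfEquivalent_Uk`). Taking $\chi_i=\chi_{\tau(i)}$ to
be a square root of $\gamma_i^{-1}$ for $i\in I^*\setminus I_{\rm diff}$ makes these parameters 1;
this is consistent because $\gamma_i=\gamma_{\tau(i)}$ there (`exists_normalizing_torus`). -/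

namespace EnvHopf

/-! ### Functoriality of the enveloping Hopf algebra -/

variable {L : Type*} [LieRing L] [LieAlgebra ℂ L]

attribute [local instance 100] LieRing.ofAssociativeRing

/-- Enveloping algebras are functorial. -/
noncomputable def envMap (F : L →ₗ⁅ℂ⁆ L) :
    UniversalEnvelopingAlgebra ℂ L →ₐ[ℂ] UniversalEnvelopingAlgebra ℂ L :=
  UniversalEnvelopingAlgebra.lift ℂ ((UniversalEnvelopingAlgebra.ι ℂ).comp F)

theorem envMap_ι (F : L →ₗ⁅ℂ⁆ L) (x : L) :
    envMap F (UniversalEnvelopingAlgebra.ι ℂ x) = UniversalEnvelopingAlgebra.ι ℂ (F x) :=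
  UniversalEnvelopingAlgebra.lift_ι_apply ℂ _ x

theorem envMap_comp_eq_id {F G : L →ₗ⁅ℂ⁆ L} (hFG : ∀ x, F (G x) = x) :
    (envMap F).comp (envMap G) = AlgHom.id ℂ _ := by
  apply UniversalEnvelopingAlgebra.hom_ext
  apply LieHom.ext
  intro x
  change envMap F (envMap G (UniversalEnvelopingAlgebra.ι ℂ x)) = UniversalEnvelopingAlgebra.ι ℂ x
  rw [envMap_ι, envMap_ι, hFG]

/-- Mutually inverse Lie algebra endomorphisms induce a Hopf algebra automorphism of `U(L)`. -/
noncomputable def envEquiv (F G : L →ₗ⁅ℂ⁆ L) (hFG : ∀ x, F (G x) = x) (hGF : ∀ x, G (F x) = x) :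
    UniversalEnvelopingAlgebra ℂ L ≃ₐc[ℂ] UniversalEnvelopingAlgebra ℂ L :=
  BialgEquiv.ofAlgEquiv
    (AlgEquiv.ofAlgHom (envMap F) (envMap G) (envMap_comp_eq_id hFG) (envMap_comp_eq_id hGF))
    -- Counit and comultiplication are algebra homomorphisms, so compatibility need only be checked
    -- on `L`, whose elements have counit zero and are primitive.
    (by
      apply UniversalEnvelopingAlgebra.hom_ext
      apply LieHom.ext
      intro x
      change counitHom L (envMap F (UniversalEnvelopingAlgebra.ι ℂ x)) =
        counitHom L (UniversalEnvelopingAlgebra.ι ℂ x)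
      rw [envMap_ι, counitHom_ι, counitHom_ι])
    (by
      apply UniversalEnvelopingAlgebra.hom_ext
      apply LieHom.ext
      intro x
      change Algebra.TensorProduct.map (envMap F) (envMap F)
          (comulHom L (UniversalEnvelopingAlgebra.ι ℂ x)) =
        comulHom L (envMap F (UniversalEnvelopingAlgebra.ι ℂ x))
      rw [envMap_ι, comulHom_ι, comulHom_ι, map_add, Algebra.TensorProduct.map_tmul,
        Algebra.TensorProduct.map_tmul, envMap_ι, map_one])

theorem envEquiv_coe (F G : L →ₗ⁅ℂ⁆ L) (hFG : ∀ x, F (G x) = x) (hGF : ∀ x, G (F x) = x) :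
    (envEquiv F G hFG hGF : UniversalEnvelopingAlgebra ℂ L →ₐ[ℂ] UniversalEnvelopingAlgebra ℂ L) =
      envMap F := rfl

end EnvHopf

namespace SatakePair

/-! ### The torus action on the Lie algebra and its commutation with θ -/

section Torus

variable {I : Type*} [DecidableEq I] (A : Matrix I I ℤ)

/-- The Serre relations are homogeneous in each generator, so they survive rescaling; this makes the
torus action well defined. -/
theorem ad_smul_pow {L : Type*} [LieRing L] [LieAlgebra ℂ L] {x y : L} {n : ℕ} (c d : ℂ)
    (hxy : (LieAlgebra.ad ℂ L x ^ n) ⁅x, y⁆ = 0) :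
    (LieAlgebra.ad ℂ L (c • x) ^ n) ⁅c • x, d • y⁆ = 0 := by
  rw [map_smul, smul_pow, LinearMap.smul_apply, smul_lie, lie_smul, map_smul, map_smul, hxy,
    smul_zero, smul_zero, smul_zero]

/-- The action of an element `χ` of the torus: `e_i ↦ χ_i e_i`, `f_i ↦ χ_i⁻¹ f_i`, `h_i ↦ h_i`. -/
noncomputable def torus (χ : I → ℂˣ) : 𝔤 A →ₗ⁅ℂ⁆ 𝔤 A :=
  liftHom (A := A) (e' := fun i => (χ i : ℂ) • e A i) (f' := fun i => (χ i : ℂ)⁻¹ • f A i)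
    (h' := h A)
    { hh := (serreRelations A).hh
      he := fun i j => by rw [lie_smul, (serreRelations A).he, smul_comm]
      hf := fun i j => by rw [lie_smul, (serreRelations A).hf, smul_neg, smul_comm]
      ef_same := fun i => by
        rw [smul_lie, lie_smul, (serreRelations A).ef_same, smul_smul,
          mul_inv_cancel₀ (χ i).ne_zero, one_smul]
      ef_ne := fun i j hij => by
        rw [smul_lie, lie_smul, (serreRelations A).ef_ne i j hij, smul_zero, smul_zero]
      ee := fun i j => ad_smul_pow _ _ ((serreRelations A).ee i j)
      ff := fun i j => ad_smul_pow _ _ ((serreRelations A).ff i j) }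

variable {A}

theorem torus_e (χ : I → ℂˣ) (i : I) : torus A χ (e A i) = (χ i : ℂ) • e A i := liftHom_e A _ i

theorem torus_f (χ : I → ℂˣ) (i : I) : torus A χ (f A i) = (χ i : ℂ)⁻¹ • f A i := liftHom_f A _ i

theorem torus_h (χ : I → ℂˣ) (i : I) : torus A χ (h A i) = h A i := liftHom_h A _ i

/-- Homomorphisms from `𝔤(A)` are determined by the images of the Chevalley generators. -/
theorem hom_ext {L : Type*} [LieRing L] [LieAlgebra ℂ L] {F G : 𝔤 A →ₗ⁅ℂ⁆ L}
    (he : ∀ i, F (e A i) = G (e A i)) (hf : ∀ i, F (f A i) = G (f A i))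
    (hh : ∀ i, F (h A i) = G (h A i)) : F = G := by
  have key : F.comp (proj A) = G.comp (proj A) := by
    apply FreeLieAlgebra.hom_ext
    intro g
    cases g with
    | H i => exact hh i
    | E i => exact he i
    | F i => exact hf i
  apply LieHom.ext
  intro x
  obtain ⟨y, rfl⟩ := Submodule.Quotient.mk_surjective _ x
  exact LieHom.congr_fun key y

theorem torus_inv_apply (χ : I → ℂˣ) (x : 𝔤 A) : torus A χ (torus A χ⁻¹ x) = x := by
  have key : (torus A χ).comp (torus A χ⁻¹) = LieHom.id := by
    apply hom_ext <;> intro i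
    · simp [torus_e, smul_smul]
    · simp [torus_f, smul_smul]
    · simp [torus_h]
  exact LieHom.congr_fun key x

theorem torus_apply_inv (χ : I → ℂˣ) (x : 𝔤 A) : torus A χ⁻¹ (torus A χ x) = x := by
  simpa using torus_inv_apply χ⁻¹ x

theorem torus_cartan (χ : I → ℂˣ) {x : 𝔤 A} (hx : x ∈ cartan A) : torus A χ x = x := by
  induction hx using Submodule.span_induction with
  | mem x hx => obtain ⟨i, rfl⟩ := hx; exact torus_h χ i
  | zero => exact map_zero _
  | add x y _ _ hx hy => rw [map_add, hx, hy]
  | smul c x _ hx => rw [map_smul, hx]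

/-- A Lie endomorphism fixing `x` commutes with `ad x`, and `nilpExp` is a finite linear combination
of powers of its argument. Nilpotency plays no role in this argument. -/
theorem commute_nilpExp_ad (F : 𝔤 A →ₗ⁅ℂ⁆ 𝔤 A) {x : 𝔤 A} (hx : F x = x) :
    Commute (F : Module.End ℂ (𝔤 A)) (nilpExp A (LieAlgebra.ad ℂ (𝔤 A) x)) := by
  have had : Commute (F : Module.End ℂ (𝔤 A)) (LieAlgebra.ad ℂ (𝔤 A) x) := by
    apply LinearMap.ext
    intro y
    change F ⁅x, y⁆ = ⁅x, F y⁆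
    rw [LieHom.map_lie, hx]
  exact Commute.sum_right _ _ _ fun n _ => (had.pow_right n).smul_right _

/-- A torus element that is trivial on the letters of a word `w` commutes with `Ad(w)`. -/
theorem commute_torus_adWord {χ : I → ℂˣ} {w : List I} (hχ : ∀ i ∈ w, χ i = 1) :
    Commute (torus A χ : Module.End ℂ (𝔤 A)) (adWord A w) := by
  refine Commute.list_prod_right _ _ fun D hD => ?_
  obtain ⟨i, hi, rfl⟩ := List.mem_map.1 hD
  have he : torus A χ (e A i) = e A i := by simp [torus_e, hχ i hi]
  have hf : torus A χ (-f A i) = -f A i := by simp [torus_f, hχ i hi]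
  exact ((commute_nilpExp_ad _ he).mul_right (commute_nilpExp_ad _ hf)).mul_right
    (commute_nilpExp_ad _ he)

theorem theta_f (τ : diagramAut A) (w : List I) (i : I) :
    theta τ w (f A i) = -adWord A w (e A (τ.1 i)) := by
  change adWord A w (relabel τ (chevalley A (f A i))) = _
  rw [show chevalley A (f A i) = -e A i from liftHom_f A _ i, map_neg,
    show relabel τ (e A i) = e A (τ.1 i) from liftHom_e A _ i, map_neg]

/-- By `theta_f` the vector is, up to sign, the image under `adWord A w` of a root vector of weight
$\alpha_{\tau(i)}$, and that operator commutes with the torus element. -/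
theorem torus_theta_f {χ : I → ℂˣ} {w : List I} (hχ : ∀ i ∈ w, χ i = 1) (τ : diagramAut A)
    (i : I) : torus A χ (theta τ w (f A i)) = (χ (τ.1 i) : ℂ) • theta τ w (f A i) := by
  have hc : torus A χ (adWord A w (e A (τ.1 i))) = adWord A w (torus A χ (e A (τ.1 i))) :=
    LinearMap.congr_fun (commute_torus_adWord hχ).eq (e A (τ.1 i))
  rw [theta_f, map_neg, hc, torus_e, map_smul, smul_neg]

/-- Pulling out $\chi_i^{-1}$ restores the coefficient 1 of $f_i$, which puts both $\chi_i$ and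
$\chi_{\tau(i)}$ into the parameter. -/
theorem torus_b {χ : I → ℂˣ} {w : List I} (hχ : ∀ i ∈ w, χ i = 1) (τ : diagramAut A)
    (i : I) (c : ℂ) :
    torus A χ (b τ w i c) = (χ i : ℂ)⁻¹ • b τ w i (c * χ i * χ (τ.1 i)) := by
  simp only [b, map_add, map_smul, torus_f, torus_theta_f hχ, smul_add, smul_smul]
  congr 2
  field_simp [(χ i).ne_zero]

/-! ### Effect of the torus on the subalgebras -/

theorem ι_mem_Uk_e {X : Set I} (τ : diagramAut A) (w : List I) (γ σ : {i // i ∉ X} → ℂ) {i : I}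
    (hi : i ∈ X) : UniversalEnvelopingAlgebra.ι ℂ (e A i) ∈ Uk X τ w γ σ :=
  Algebra.subset_adjoin (.inl (.inl (.inl ⟨i, hi, rfl⟩)))

theorem ι_mem_Uk_f {X : Set I} (τ : diagramAut A) (w : List I) (γ σ : {i // i ∉ X} → ℂ) {i : I}
    (hi : i ∈ X) : UniversalEnvelopingAlgebra.ι ℂ (f A i) ∈ Uk X τ w γ σ :=
  Algebra.subset_adjoin (.inl (.inl (.inr ⟨i, hi, rfl⟩)))

theorem ι_mem_Uk_cartanFixed {X : Set I} (τ : diagramAut A) (w : List I)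
    (γ σ : {i // i ∉ X} → ℂ) {x : 𝔤 A} (hx : x ∈ cartanFixed τ w) :
    UniversalEnvelopingAlgebra.ι ℂ x ∈ Uk X τ w γ σ :=
  Algebra.subset_adjoin (.inl (.inr ⟨x, hx, rfl⟩))

/-- The constant terms do not matter, because `U(𝔨_γ)_σ` is unital. -/
theorem ι_mem_Uk_b {X : Set I} (τ : diagramAut A) (w : List I) (γ σ : {i // i ∉ X} → ℂ)
    (i : {i // i ∉ X}) : UniversalEnvelopingAlgebra.ι ℂ (b τ w i.1 (γ i)) ∈ Uk X τ w γ σ := by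
  have hb : UniversalEnvelopingAlgebra.ι ℂ (b τ w i.1 (γ i)) + algebraMap ℂ (U𝔤 A) (σ i) ∈
      Uk X τ w γ σ := Algebra.subset_adjoin (.inr ⟨i, rfl⟩)
  simpa using sub_mem hb ((Uk X τ w γ σ).algebraMap_mem (σ i))

/-- A torus element that is trivial on `X` maps `U(𝔨_γ)_σ` into `U(𝔨_γ')_σ'`, where
`γ'_i = γ_i χ_i χ_{τ(i)}`. -/
theorem map_torus_Uk_le {X : Set I} {χ : I → ℂˣ} (hχ : ∀ i ∈ X, χ i = 1) (τ : diagramAut A)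
    {w : List I} (hw : ∀ i ∈ w, i ∈ X) {γ γ' : {i // i ∉ X} → ℂ}
    (hγ : ∀ i, γ' i = γ i * χ i.1 * χ (τ.1 i.1)) (σ σ' : {i // i ∉ X} → ℂ) :
    (Uk X τ w γ σ).map (EnvHopf.envMap (torus A χ)) ≤ Uk X τ w γ' σ' := by
  rw [Subalgebra.map_le, Uk, Algebra.adjoin_le_iff]
  rintro _ (((⟨i, hi, rfl⟩ | ⟨i, hi, rfl⟩) | ⟨x, hx, rfl⟩) | ⟨i, rfl⟩)
  · change EnvHopf.envMap (torus A χ) _ ∈ Uk X τ w γ' σ'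
    rw [EnvHopf.envMap_ι, torus_e, hχ i hi, Units.val_one, one_smul]
    exact ι_mem_Uk_e τ w γ' σ' hi
  · change EnvHopf.envMap (torus A χ) _ ∈ Uk X τ w γ' σ'
    rw [EnvHopf.envMap_ι, torus_f, hχ i hi, Units.val_one, inv_one, one_smul]
    exact ι_mem_Uk_f τ w γ' σ' hi
  · change EnvHopf.envMap (torus A χ) _ ∈ Uk X τ w γ' σ'
    rw [EnvHopf.envMap_ι, torus_cartan χ hx.1]
    exact ι_mem_Uk_cartanFixed τ w γ' σ' hx
  · change EnvHopf.envMap (torus A χ) _ ∈ Uk X τ w γ' σ'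
    -- The image is a multiple of the new $b_i$ plus the old scalar $\sigma_i$. Both summands lie in
    -- the target for every choice of $\sigma'$.
    rw [map_add, AlgHom.commutes, EnvHopf.envMap_ι, torus_b (fun i hi => hχ i (hw i hi)), ← hγ,
      map_smul]
    exact add_mem (Subalgebra.smul_mem _ (ι_mem_Uk_b τ w γ' σ' i) _)
      (Subalgebra.algebraMap_mem _ _)

theorem hopfEquivalent_Uk {X : Set I} {χ : I → ℂˣ} (hχ : ∀ i ∈ X, χ i = 1) (τ : diagramAut A)
    {w : List I} (hw : ∀ i ∈ w, i ∈ X) {γ γ' : {i // i ∉ X} → ℂ}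
    (hγ : ∀ i, γ' i = γ i * χ i.1 * χ (τ.1 i.1)) (σ σ' : {i // i ∉ X} → ℂ) :
    HopfEquivalent (Uk X τ w γ σ) (Uk X τ w γ' σ') := by
  refine ⟨EnvHopf.envEquiv (torus A χ) (torus A χ⁻¹) (torus_inv_apply χ) (torus_apply_inv χ), ?_⟩
  rw [EnvHopf.envEquiv_coe]
  -- For the other inclusion, the same lemma is applied to $\chi^{-1}$, which carries $\gamma'$ back
  -- to $\gamma$.
  refine le_antisymm (fun a ha => ?_) (map_torus_Uk_le hχ τ hw hγ σ σ')
  refine ⟨EnvHopf.envMap (torus A χ⁻¹) a, map_torus_Uk_le (χ := χ⁻¹) (γ := γ') ?_ τ hw ?_ σ' σ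
    ⟨a, ha, rfl⟩, AlgHom.congr_fun (EnvHopf.envMap_comp_eq_id (torus_inv_apply χ)) a⟩
  · intro i hi
    simp [hχ i hi]
  · intro i
    rw [hγ, Pi.inv_apply, Pi.inv_apply, Units.val_inv_eq_inv_val, Units.val_inv_eq_inv_val]
    field_simp [(χ i.1).ne_zero, (χ (τ.1 i.1)).ne_zero]

end Torus

/-! ### Choice of the torus element -/

/-- A torus element that is trivial on `X` and normalizes the parameters `γ_i` with
`i ∈ I* \ I_diff`. -/
theorem exists_normalizing_torus {I : Type*} [Fintype I] [DecidableEq I] {A : Matrix I I ℤ}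
    {X : Set I} {τ : diagramAut A} (hXτ : IsCompatibleDecoration X τ) {w : List I} {Istar : Set I}
    (hIstar : IsOrbitSection X τ Istar)
    {γ : {i // i ∉ X} → ℂ} (hγ : γ ∈ Gam X τ w Istar) :
    ∃ χ : I → ℂˣ, (∀ i ∈ X, χ i = 1) ∧ ∀ i : {i // i ∉ X}, i.1 ∈ Istar → i.1 ∉ Idiff τ w Istar →
      γ i * χ i.1 * χ (τ.1 i.1) = 1 := by
  classical
  have hsq : ∀ z : ℂˣ, ∃ r : ℂˣ, z * r * r = 1 := by
    intro z
    obtain ⟨r, hr⟩ := IsAlgClosed.exists_pow_nat_eq (z : ℂ)⁻¹ two_pos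
    have hr0 : r ≠ 0 := by
      rintro rfl
      simp [eq_comm] at hr
    refine ⟨Units.mk0 r hr0, Units.ext ?_⟩
    simp [mul_assoc, ← sq, hr]
  -- The square root is fixed once as a function of the number, so equal parameters receive equal
  -- roots.
  choose root hroot using hsq
  have hτ : ∀ i, τ.1 i ∈ X → i ∈ X := fun i hi => by
    have := Set.mem_image_of_mem τ.1 hi
    rwa [hXτ.image, hXτ.sq] at this
  let g : I → ℂˣ := fun i => if hi : i ∉ X then Units.mk0 (γ ⟨i, hi⟩) (hγ.1 _) else 1
  let S : Set I := {i | i ∈ Istar ∧ i ∉ Idiff τ w Istar}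
  -- The support is the union of the τ-orbits meeting `S`; it avoids `X` because `Istar` does and
  -- `X` is τ-stable.
  refine ⟨fun i => if i ∈ S ∨ τ.1 i ∈ S then root (g i) else 1, fun i hi => if_neg ?_,
    fun i hi hi' => ?_⟩
  · rintro (h | h)
    · exact hIstar.subset i h.1 hi
    · refine hIstar.subset _ h.1 ?_
      rw [← hXτ.image]
      exact Set.mem_image_of_mem _ hi
  · have hS : i.1 ∈ S := ⟨hi, hi'⟩
    have hτi : τ.1 i.1 ∉ X := fun h => i.2 (hτ _ h)
    -- The defining condition of Γ gives $\chi_i=\chi_{\tau(i)}$, so the product in the goal becomes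
    -- $\gamma_i$ times the square of a single root.
    have hg : g (τ.1 i.1) = g i.1 := Units.ext (by
      simp only [g, dif_pos hτi, dif_pos i.2, Units.val_mk0]
      exact (hγ.2 i ⟨_, hτi⟩ hi hi' rfl).symm)
    have hgi : (g i.1 : ℂ) = γ i := by simp only [g, dif_pos i.2, Units.val_mk0]
    simp only [hXτ.sq, hS, true_or, or_true, if_true, hg]
    rw [← hgi]
    exact congrArg Units.val (hroot (g i.1))

end SatakePair

/-! ### Conclusion -/

open SatakePair in
theorem mainTheorem7 {I : Type*} [Fintype I] [DecidableEq I]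
    (A : Matrix I I ℤ) (hA : IsCartanMatrix A)
    (X : Set I) (τ : diagramAut A) (hXτ : IsGSat X τ)
    (w : List I) (hw : IsLongestWord A X w)
    (Istar : Set I) (hIstar : IsOrbitSection X τ Istar)
    (γ : {i // i ∉ X} → ℂ) (hγ : γ ∈ Gam X τ w Istar) (σ : {i // i ∉ X} → ℂ) :
    ∃ γ' ∈ GamTilde X τ w Istar, ∃ σ' ∈ Sig X τ w Istar,
      HopfEquivalent (Uk X τ w γ σ) (Uk X τ w γ' σ') := by
  classical
  obtain ⟨χ, hχX, hχ⟩ := exists_normalizing_torus hXτ.toIsCompatibleDecoration hIstar hγ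
  refine ⟨fun i => γ i * χ i.1 * χ (τ.1 i.1), ⟨⟨fun i => ?_, fun i j hi hi' hj => ?_⟩, hχ⟩,
    -- The value $\chi_i\sigma_i$ is what the torus turns $\sigma_i$ into once $\chi_i^{-1}$ is
    -- factored out of the generator; entries that Σ forces to vanish are set to 0, which leaves the
    -- subalgebra unchanged.
    fun i => if i.1 ∈ Istar ∧ i.1 ∉ Insf τ w then 0 else χ i.1 * σ i,
    fun i hi hi' => if_pos ⟨hi, hi'⟩, hopfEquivalent_Uk hχX τ hw.mem (fun _ => rfl) _ _⟩
  · exact mul_ne_zero (mul_ne_zero (hγ.1 i) (χ i.1).ne_zero) (χ (τ.1 i.1)).ne_zero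
  -- The new parameters stay in Γ because the factor $\chi_i\chi_{\tau(i)}$ is symmetric under
  -- $i\leftrightarrow\tau(i)$.
  · have hτj : τ.1 j.1 = i.1 := by rw [hj, hXτ.sq]
    beta_reduce
    rw [hτj, hj, hγ.2 i j hi hi' hj, mul_right_comm]
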